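/- **Setting.** All Hilbert spaces are finite-dimensional with fixed computational bases. Let $N\ge 1$, $\mathcal N=\{1,\dots,N\}$, let $\mathcal H^P$, $\mathcal H^F$ be Hilbert spaces (global past and future) and, for $k\in\mathcal N$, let $\mathcal H^{A_k^I}$, $\mathcal H^{A_k^O}$ be the input and output spaces of the $k$-th external operation. For $\mathcal K\subseteq\mathcal N$ put $\mathcal H^{A_{\mathcal K}^{IO}}=\bigotimes_{k\in\mathcal K}\mathcal H^{A_k^I}\otimes\mathcal H^{A_k^O}$; juxtaposed superscripts denote tensor products. For $V:\mathcal H^X\to\mathcal H^Y$ the Choi vector is $|V\rangle\rangle=\sum_i|i\rangle\otimes V|i\rangle\in\mathcal H^{XY}$. The link product of $|a\rangle\in\mathcal H^{XY}$ and $|b\rangle\in\mathcal H^{YZ}$ is $|a\rangle*|b\rangle=\sum_i(\mathbb 1^X\otimes\langle i|^Y)|a\rangle\otimes(\langle i|^Y\otimes\mathbb 1^Z)|b\rangle$, and for operators $A\in\mathcal L(\mathcal H^{XY})$, $B\in\mathcal L(\mathcal H^{YZ})$ it is $A*B=\operatorname{Tr}_Y[(A^{T_Y}\otimes\mathbb 1^Z)(\mathbb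 1^X\otimes B)]$. **Circuits.** A *quantum circuit with quantum control of causal order* (QC-QC) consists of ancillary spaces $\mathcal H^{\alpha_1},\dots,\mathcal H^{\alpha_N},\mathcal H^{\alpha_F}$ and operators $V_{\emptyset,\emptyset}^{\to k_1}:\mathcal H^P\to\mathcal H^{A_{k_1}^I\alpha_1}$; $V_{\mathcal K_{n-1},k_n}^{\to k_{n+1}}:\mathcal H^{A_{k_n}^O\alpha_n}\to\mathcal H^{A_{k_{n+1}}^I\alpha_{n+1}}$ for $1\le n\le N-1$, $\mathcal K_{n-1}\subset\mathcal N$ with $|\mathcal K_{n-1}|=n-1$ and distinct $k_n,k_{n+1}\in\mathcal N\setminus\mathcal K_{n-1}$; and $V_{\mathcal N\setminus k_N,k_N}^{\to F}:\mathcal H^{A_{k_N}^O\alpha_N}\to\mathcal H^{F\alpha_F}$, subject to the following trace-preserving (TP) conditions. For $1\le n\le N$, $|\mathcal K_{n-1}|=n-1$ and $k_n\notin\mathcal K_{n-1}$ let $$|w_{(\mathcal K_{n-1},k_n)}\rangle=\sum_{(k_1,\dots,k_{n-1})}|V_{\emptyset,\emptyset}^{\to k_1}\rangle\rangle*|V_{\emptyset,k_1}^{\to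 k_2}\rangle\rangle*\cdots*|V_{\{k_1,\dots,k_{n-2}\},k_{n-1}}^{\to k_n}\rangle\rangle\in\mathcal H^{PA_{\mathcal K_{n-1}}^{IO}A_{k_n}^I\alpha_n},$$ the sum being over all orderings of $\mathcal K_{n-1}$, and let $|w_{(\mathcal N,F)}\rangle\in\mathcal H^{PA_{\mathcal N}^{IO}F\alpha_F}$ be the analogous sum over all orderings $(k_1,\dots,k_N)$ of $\mathcal N$, the last factor being $|V_{\{k_1,\dots,k_{N-1}\},k_N}^{\to F}\rangle\rangle$. Writing $[w]=|w\rangle\langle w|$, the TP conditions are $$\sum_{k_1}\operatorname{Tr}_{A_{k_1}^I\alpha_1}[w_{(\emptyset,k_1)}]=\mathbb 1^P,$$ $$\sum_{k_{n+1}\notin\mathcal K_n}\operatorname{Tr}_{A_{k_{n+1}}^I\alpha_{n+1}}[w_{(\mathcal K_n,k_{n+1})}]=\sum_{k_n\in\mathcal K_n}\operatorname{Tr}_{\alpha_n}[w_{(\mathcal K_n\setminus k_n,k_n)}]\otimes\mathbb 1^{A_{k_n}^O}\quad(1\le n\le N-1,\ |\mathcal K_n|=n),$$ $$\operatorname{Tr}_{F\alpha_F}[w_{(\mathcal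 N,F)}]=\sum_{k_N\in\mathcal N}\operatorname{Tr}_{\alpha_N}[w_{(\mathcal N\setminus k_N,k_N)}]\otimes\mathbb 1^{A_{k_N}^O}.$$ Given external operations (single Kraus operators) $A_k:\mathcal H^{A_k^I}\to\mathcal H^{A_k^O}$, the circuit uses at time slot $n$ a control system with orthonormal basis states $|\mathcal K_{n-1},k_n\rangle$ ($|\mathcal K_{n-1}|=n-1$, $k_n\notin\mathcal K_{n-1}$), the target system being in $\mathcal H^{A_{k_n}^I}$ (before the slot) or $\mathcal H^{A_{k_n}^O}$ (after it) when the control is in that state. It applies in succession $\sum_{k_1}V_{\emptyset,\emptyset}^{\to k_1}\otimes|\emptyset,k_1\rangle$; then, at each time slot $n=1,\dots,N$, $\sum_{\mathcal K_{n-1},k_n}A_{k_n}\otimes\mathbb 1^{\alpha_n}\otimes|\mathcal K_{n-1},k_n\rangle\langle\mathcal K_{n-1},k_n|$; between slots $n$ and $n+1$, $\sum_{\mathcal K_{n-1},k_n,k_{n+1}}V_{\mathcal K_{n-1},k_n}^{\to k_{n+1}}\otimes|\mathcal K_{n-1}\cup k_n,k_{n+1}\rangle\langle\mathcal K_{n-1},k_n|$;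 and finally $\sum_{k_N}V_{\mathcal N\setminus k_N,k_N}^{\to F}\otimes\langle\mathcal N\setminus k_N,k_N|$. The composition is an operator $V_A:\mathcal H^P\to\mathcal H^{F\alpha_F}$. The *process matrix* of the circuit is the Hermitian $W\in\mathcal L(\mathcal H^{PA_{\mathcal N}^{IO}F})$ such that, for all $A_1,\dots,A_N$, $$\operatorname{Tr}_{\alpha_F}|V_A\rangle\rangle\langle\langle V_A|=\big(|A_1\rangle\rangle\langle\langle A_1|\otimes\cdots\otimes|A_N\rangle\rangle\langle\langle A_N|\big)*W .$$ **Proposition 7 (Characterisation of QC-QCs).** A matrix $W\in\mathcal L(\mathcal H^{PA_{\mathcal N}^{IO}F})$ is the process matrix of a quantum circuit with quantum control of causal order if and only if $W$ is positive semidefinite and there exist positive semidefinite matrices $W_{(\mathcal K_{n-1},k_n)}\in\mathcal L(\mathcal H^{PA_{\mathcal K_{n-1}}^{IO}A_{k_n}^I})$, for all strict subsets $\mathcal K_{n-1}\subsetneq\mathcal N$ and all $k_n\in\mathcal N\setminus\mathcal K_{n-1}$, such that $$\sum_{k_1\in\mathcal N}\operatorname{Tr}_{A_{k_1}^I}W_{(\emptyset,k_1)}=\mathbb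 1^P,$$ $$\forall\,\emptyset\subsetneq\mathcal K_n\subsetneq\mathcal N:\quad\sum_{k_{n+1}\in\mathcal N\setminus\mathcal K_n}\operatorname{Tr}_{A_{k_{n+1}}^I}W_{(\mathcal K_n,k_{n+1})}=\sum_{k_n\in\mathcal K_n}W_{(\mathcal K_n\setminus k_n,k_n)}\otimes\mathbb 1^{A_{k_n}^O},$$ $$\operatorname{Tr}_FW=\sum_{k_N\in\mathcal N}W_{(\mathcal N\setminus k_N,k_N)}\otimes\mathbb 1^{A_{k_N}^O}.$$ -/

import Mathlib

open scoped ComplexOrder Kronecker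

noncomputable section

namespace QCQC

/-! Hilbert spaces are finite-dimensional and given by the index types of their computational
bases: a vector of `H^X` is a function `X → ℂ`, an operator is a complex matrix, and
`H^X ⊗ H^Y` is indexed by `X × Y`. -/

section Tensor

variable {X Y : Type*}

/-- The rank-one operator `|v⟩⟨v|`. -/
def ketbra (v : X → ℂ) : Matrix X X ℂ :=
  Matrix.vecMulVec v (star v)

/-- Partial trace over the right tensor factor. -/
def trRight [Fintype Y] (M : Matrix (X × Y) (X × Y) ℂ) : Matrix X X ℂ :=
  Matrix.of fun x x' => ∑ y, M (x, y) (x', y)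

/-- The Choi vector `∑ᵢ |i⟩ ⊗ V|i⟩` of an operator `V : H^X → H^Y`. -/
def choiVec (V : Matrix Y X ℂ) : X × Y → ℂ :=
  fun q => V q.2 q.1

end Tensor

/-! There are `N = m + 1 ≥ 1` external operations, labelled by `Fin (m + 1)`; the `k`-th one has
input space `H^{A_k^I}` indexed by `AI k` and output space `H^{A_k^O}` indexed by `AO k`. -/

variable {m : ℕ}

/-- Basis of `H^{A_K^{IO}} = ⨂_{k ∈ K} H^{A_k^I} ⊗ H^{A_k^O}`. -/
abbrev InOut {m : ℕ} (AI AO : Fin (m + 1) → Type*) (K : Finset (Fin (m + 1))) : Type _ :=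
  ∀ k : K, AI k × AO k

/-- The reordering of tensor factors
`H^{P A_K^{IO}} ≅ H^{P A_{K∖k}^{IO}} ⊗ H^{A_k^I} ⊗ H^{A_k^O}` for `k ∈ K`, on basis labels. -/
def split {P : Type*} {AI AO : Fin (m + 1) → Type*} {K : Finset (Fin (m + 1))} (k : K)
    (q : P × InOut AI AO K) :
    ((P × InOut AI AO (K.erase (k : Fin (m + 1)))) × AI k) × AO k :=
  (((q.1, fun j => q.2 ⟨j, Finset.mem_of_mem_erase j.2⟩), (q.2 k).1), (q.2 k).2)

/-- `M ⊗ 𝟙^{A_k^O}` as an operator on `H^{P A_K^{IO}}`, for `k ∈ K` and `M` an operator on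
`H^{P A_{K∖k}^{IO} A_k^I}`. -/
def tensorId {P : Type*} {AI AO : Fin (m + 1) → Type*} [∀ k, DecidableEq (AO k)]
    {K : Finset (Fin (m + 1))} (k : K)
    (M : Matrix ((P × InOut AI AO (K.erase (k : Fin (m + 1)))) × AI k)
      ((P × InOut AI AO (K.erase (k : Fin (m + 1)))) × AI k) ℂ) :
    Matrix (P × InOut AI AO K) (P × InOut AI AO K) ℂ :=
  (M ⊗ₖ (1 : Matrix (AO k) (AO k) ℂ)).submatrix (split k) (split k)

/-- The link product `(C_1 ⊗ ⋯ ⊗ C_N) * W ∈ L(H^{PF})` of Choi matrices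
`C_k ∈ L(H^{A_k^I A_k^O})` with `W ∈ L(H^{P A_N^{IO} F})`. -/
def plug {P F : Type*} {AI AO : Fin (m + 1) → Type*}
    [∀ k, Fintype (AI k)] [∀ k, Fintype (AO k)]
    (C : ∀ k, Matrix (AI k × AO k) (AI k × AO k) ℂ)
    (W : Matrix ((P × InOut AI AO Finset.univ) × F) ((P × InOut AI AO Finset.univ) × F) ℂ) :
    Matrix (P × F) (P × F) ℂ :=
  Matrix.of fun q q' => ∑ x : InOut AI AO Finset.univ, ∑ x' : InOut AI AO Finset.univ,
    (∏ k, C k (x ⟨k, Finset.mem_univ k⟩) (x' ⟨k, Finset.mem_univ k⟩)) *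
      W ((q.1, x), q.2) ((q'.1, x'), q'.2)

/-- The internal operations of a generalised circuit with coherently controlled order, before
trace preservation is imposed. The ancillary space `H^{α_n}` has dimension `anc n`
(`1 ≤ n ≤ N`) and `H^{α_F}` has dimension `ancF`.
* `first k` is `V_{∅,∅}^{→k} : H^P → H^{A_k^I α_1}`;
* `step n K k k'` is `V_{K,k}^{→k'} : H^{A_k^O α_n} → H^{A_{k'}^I α_{n+1}}`; it matters only for
  `|K| = n - 1`, `k ∉ K` and `k' ∉ K ∪ {k}`;
* `last k` is `V_{𝒩∖k,k}^{→F} : H^{A_k^O α_N} → H^{F α_F}`. -/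
structure Internal (P : Type*) (AI AO : Fin (m + 1) → Type*) (F : Type*) where
  anc : ℕ → ℕ
  ancF : ℕ
  first : ∀ k, Matrix (AI k × Fin (anc 1)) P ℂ
  step : ∀ (n : ℕ) (_ : Finset (Fin (m + 1))) (k k' : Fin (m + 1)),
    Matrix (AI k' × Fin (anc (n + 1))) (AO k × Fin (anc n)) ℂ
  last : ∀ k, Matrix (F × Fin ancF) (AO k × Fin (anc (m + 1))) ℂ

namespace Internal

variable {P F : Type*} {AI AO : Fin (m + 1) → Type*}

section Vectors

variable (C : Internal P AI AO F)

/-- The link product of Choi vectors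
`|w_{(k_1,…,k_n,k)}⟩ = |V_{∅,∅}^{→k_1}⟩⟩ * |V_{∅,k_1}^{→k_2}⟩⟩ * ⋯ * |V_{{k_1,…,k_{n-1}},k_n}^{→k}⟩⟩`
in `H^P ⊗ (⨂_i H^{A_{k_i}^{IO}}) ⊗ H^{A_k^I} ⊗ H^{α_{n+1}}`, where `k_i = s (i - 1)`, and `x` lists
the basis labels of the spaces `H^{A_{k_i}^{IO}}`. -/
def wSeq : (n : ℕ) → (s : Fin n → Fin (m + 1)) → (x : ∀ i, AI (s i) × AO (s i)) → P →
    (k : Fin (m + 1)) → AI k → Fin (C.anc (n + 1)) → ℂ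
  | 0, _, _, p, k, i, a => choiVec (C.first k) (p, (i, a))
  | n + 1, s, x, p, k, i, a => ∑ b : Fin (C.anc (n + 1)),
      wSeq n (fun j => s j.castSucc) (fun j => x j.castSucc) p
          (s (Fin.last n)) (x (Fin.last n)).1 b *
        choiVec
          (C.step (n + 1) (Finset.univ.image fun j : Fin n => s j.castSucc) (s (Fin.last n)) k)
          (((x (Fin.last n)).2, b), (i, a))

/-- `|w_{(K,k)}⟩ ∈ H^{P A_K^{IO} A_k^I α_{n+1}}` for `|K| = n`: the sum of the vectors
`|w_{(k_1,…,k_n,k)}⟩` over all orderings `(k_1,…,k_n)` of `K`. -/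
def w (n : ℕ) (K : Finset (Fin (m + 1))) (k : Fin (m + 1)) :
    ((P × InOut AI AO K) × AI k) × Fin (C.anc (n + 1)) → ℂ :=
  fun q => ∑ s : Fin n ≃ K,
    C.wSeq n (fun j => s j) (fun j => q.1.1.2 (s j)) q.1.1.1 k q.1.2 q.2

/-- `|w_{(𝒩,F)}⟩ ∈ H^{P A_𝒩^{IO} F α_F}`: the sum over all orders `(k_1,…,k_N)` of
`|w_{(k_1,…,k_N)}⟩ * |V_{{k_1,…,k_{N-1}},k_N}^{→F}⟩⟩`. -/
def wF : ((P × InOut AI AO Finset.univ) × F) × Fin C.ancF → ℂ :=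
  fun q => ∑ s : Fin (m + 1) ≃ (Finset.univ : Finset (Fin (m + 1))),
    ∑ b : Fin (C.anc (m + 1)),
      C.wSeq m (fun j => s j.castSucc) (fun j => q.1.1.2 (s j.castSucc)) q.1.1.1
          (s (Fin.last m)) (q.1.1.2 (s (Fin.last m))).1 b *
        choiVec (C.last (s (Fin.last m))) (((q.1.1.2 (s (Fin.last m))).2, b), (q.1.2, q.2))

end Vectors

/-- The trace-preserving conditions: every internal operation of the circuit, including the action
on the control system, is an isometry on its effective input space. In the first condition
`H^{P A_∅^{IO}}` is `H^P`. -/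
structure IsTP [DecidableEq P] [Fintype F] [∀ k, Fintype (AI k)] [∀ k, DecidableEq (AI k)]
    [∀ k, DecidableEq (AO k)] (C : Internal P AI AO F) : Prop where
  first : ∑ k, trRight (trRight (ketbra (C.w 0 ∅ k))) = 1
  step : ∀ (n : ℕ) (K : Finset (Fin (m + 1))), n < m → K.card = n + 1 →
    ∑ k ∈ Kᶜ, trRight (trRight (ketbra (C.w (n + 1) K k))) =
      ∑ k : K, tensorId k (trRight (ketbra (C.w n (K.erase (k : Fin (m + 1))) k)))
  last : trRight (trRight (ketbra C.wF)) =
    ∑ k : (Finset.univ : Finset (Fin (m + 1))),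
      tensorId k (trRight (ketbra (C.w m (Finset.univ.erase (k : Fin (m + 1))) k)))

/-! ### The map induced by the circuit

At the `(n+1)`-th time slot the control system has the basis states `|K, k⟩` with `|K| = n` and
`k ∉ K`. The joint space of the target, ancillary and control systems just before (after) the slot
is the orthogonal sum over `(K, k)` of `H^{A_k^I α_{n+1}}` (of `H^{A_k^O α_{n+1}}`); when all `AI k`
coincide and all `AO k` coincide, this is the tensor product of target, ancilla and control. -/

/-- Basis states `|K, k⟩` of the control system at the `(n+1)`-th time slot. -/
abbrev Ctl (m n : ℕ) : Type :=
  {c : Finset (Fin (m + 1)) × Fin (m + 1) // c.1.card = n ∧ c.2 ∉ c.1}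

/-- Target, ancilla and control just before the `(n+1)`-th time slot. -/
abbrev Pre (C : Internal P AI AO F) (n : ℕ) : Type _ :=
  Σ c : Ctl m n, AI c.1.2 × Fin (C.anc (n + 1))

/-- Target, ancilla and control just after the `(n+1)`-th time slot. -/
abbrev Post (C : Internal P AI AO F) (n : ℕ) : Type _ :=
  Σ c : Ctl m n, AO c.1.2 × Fin (C.anc (n + 1))

section Circuit

variable (C : Internal P AI AO F)

/-- `∑_k V_{∅,∅}^{→k} ⊗ |∅,k⟩`. -/
def firstOp : Matrix (C.Pre 0) P ℂ :=
  Matrix.of fun r p => C.first r.1.1.2 r.2 p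

/-- `∑_{K,k,k'} V_{K,k}^{→k'} ⊗ |K ∪ k, k'⟩⟨K, k|`, applied between the time slots
`n + 1` and `n + 2`. -/
def stepOp (n : ℕ) : Matrix (C.Pre (n + 1)) (C.Post n) ℂ :=
  Matrix.of fun r q =>
    if r.1.1.1 = insert q.1.1.2 q.1.1.1 then
      C.step (n + 1) q.1.1.1 q.1.1.2 r.1.1.2 r.2 q.2
    else 0

/-- `∑_k V_{𝒩∖k,k}^{→F} ⊗ ⟨𝒩∖k, k|`. -/
def lastOp : Matrix (F × Fin C.ancF) (C.Post m) ℂ :=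
  Matrix.of fun r q => C.last q.1.1.2 r q.2

/-- `∑_{K,k} A_k ⊗ 𝟙 ⊗ |K,k⟩⟨K,k|`: the external operations applied at the `(n+1)`-th time slot. -/
def extOp (A : ∀ k, Matrix (AO k) (AI k) ℂ) (n : ℕ) : Matrix (C.Post n) (C.Pre n) ℂ :=
  Matrix.blockDiagonal' fun c : Ctl m n =>
    A c.1.2 ⊗ₖ (1 : Matrix (Fin (C.anc (n + 1))) (Fin (C.anc (n + 1))) ℂ)

variable [∀ k, Fintype (AI k)] [∀ k, Fintype (AO k)]

/-- The operator applied by the circuit up to just before the `(n+1)`-th time slot. -/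
def evol (A : ∀ k, Matrix (AO k) (AI k) ℂ) : (n : ℕ) → Matrix (C.Pre n) P ℂ
  | 0 => C.firstOp
  | n + 1 => C.stepOp n * (C.extOp A n * evol A n)

/-- The global operator `H^P → H^{F α_F}` of the circuit with external operations `A_k`. -/
def globalOp (A : ∀ k, Matrix (AO k) (AI k) ℂ) : Matrix (F × Fin C.ancF) P ℂ :=
  C.lastOp * (C.extOp A m * C.evol A m)

/-- The Choi matrix of the map from `L(H^P)` to `L(H^F)` induced by the circuit, `α_F` being
discarded. -/
def inducedChoi (A : ∀ k, Matrix (AO k) (AI k) ℂ) : Matrix (P × F) (P × F) ℂ :=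
  trRight (ketbra fun q : (P × F) × Fin C.ancF => choiVec (C.globalOp A) (q.1.1, (q.1.2, q.2)))

/-- `W` is the process matrix of the circuit: it is Hermitian, and for all external operations `A_k`
the induced map has the Choi matrix `(|A_1⟩⟩⟨⟨A_1| ⊗ ⋯ ⊗ |A_N⟩⟩⟨⟨A_N|) * W`. -/
def HasProcessMatrix
    (W : Matrix ((P × InOut AI AO Finset.univ) × F) ((P × InOut AI AO Finset.univ) × F) ℂ) : Prop :=
  W.IsHermitian ∧ ∀ A : ∀ k, Matrix (AO k) (AI k) ℂ,
    C.inducedChoi A = plug (fun k => ketbra (choiVec (A k))) W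

end Circuit

end Internal

/-- `W` is the process matrix of a quantum circuit with quantum control of causal order. -/
def IsProcessMatrixOfQCQC {P F : Type*} {AI AO : Fin (m + 1) → Type*}
    [DecidableEq P] [Fintype F] [∀ k, Fintype (AI k)] [∀ k, DecidableEq (AI k)]
    [∀ k, Fintype (AO k)] [∀ k, DecidableEq (AO k)]
    (W : Matrix ((P × InOut AI AO Finset.univ) × F) ((P × InOut AI AO Finset.univ) × F) ℂ) : Prop :=
  ∃ C : Internal P AI AO F, C.IsTP ∧ C.HasProcessMatrix W

end QCQC

end

/-! The process matrix of a circuit can only be `Tr_{α_F} [w_{(𝒩,F)}]`. Unfolding the control system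
slot by slot gives the amplitudes `w` contracted with the external operations (`evol_apply`,
`inducedChoi_eq`), and pure operations determine a matrix because rank-one operators span
(`eq_of_forall_plug_ketbra_eq`). For necessity take `W_{(K,k)} = Tr_α [w_{(K,k)}]`: this is positive
semidefinite, and the TP conditions are the required equations.

For sufficiency, factor `W_{(K,k)} = B Bᴴ` and `W = BF BFᴴ`, and read the column index as the
ancilla. Each equation for `K ≠ ∅` then says `X Xᴴ = U Uᴴ`, where `X` collects the factors that
follow `K`, with the traced space moved to the columns, and `U` has the blocks `B_{(K∖k,k)} ⊗
𝟙^{A_k^O}`. Hence `X` and `U` have the same range and `X = U V`. The blocks of `V` serve as the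
internal operations (`exists_internal_of_mul_conjTranspose_eq`). By induction the vectors `w` of
this circuit are the chosen factors. Since the TP conditions constrain only these vectors, `V` need
not be an isometry outside the subspace actually reached. -/

namespace QCQC

/-! ### Factorisations of positive matrices, and spanning by rank-one operators. -/

section LinearAlgebra

open scoped MatrixOrder in
/-- A positive semidefinite matrix is `B * Bᴴ` with any sufficiently large number of columns. -/
theorem exists_eq_mul_conjTranspose {R : Type*} [Fintype R] [DecidableEq R]
    {A : Matrix R R ℂ} (hA : A.PosSemidef) {d : ℕ} (hd : Fintype.card R ≤ d) :
    ∃ B : Matrix R (Fin d) ℂ, B * B.conjTranspose = A := by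
  obtain ⟨B₀, hB₀⟩ := CStarAlgebra.nonneg_iff_eq_star_mul_self.mp hA.nonneg
  obtain ⟨f⟩ : Nonempty (R ↪ Fin d) :=
    Function.Embedding.nonempty_of_card_le (by simpa using hd)
  -- Right multiplication by `E` pads a square factor with zero columns, and `E Eᴴ = 1` leaves the
  -- product unchanged.
  let E : Matrix R (Fin d) ℂ := Matrix.of fun r a => if f r = a then 1 else 0
  have hE : E * E.conjTranspose = 1 := by
    ext r r'
    simp [E, Matrix.mul_apply, Matrix.one_apply, eq_comm]
  refine ⟨B₀.conjTranspose * E, ?_⟩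
  rw [Matrix.conjTranspose_mul, Matrix.conjTranspose_conjTranspose, Matrix.mul_assoc,
    ← Matrix.mul_assoc E, hE, Matrix.one_mul, hB₀,
    Matrix.star_eq_conjTranspose]

/-- One inclusion is clear, and `U Uᴴ` has the same rank as `U`. -/
theorem range_mulVecLin_mul_conjTranspose {R S : Type*} [Fintype R] [Fintype S]
    (U : Matrix R S ℂ) :
    LinearMap.range (U * U.conjTranspose).mulVecLin = LinearMap.range U.mulVecLin := by
  apply Submodule.eq_of_le_of_finrank_eq
  · rw [Matrix.mulVecLin_mul]
    exact LinearMap.range_comp_le_range _ _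
  · exact Matrix.rank_self_mul_conjTranspose U

/-- Matrices with the same Gram matrix of rows have the same range, so one factors through the
other. -/
theorem exists_eq_mul_of_mul_conjTranspose_eq {R S T : Type*} [Fintype R] [Fintype S] [Fintype T]
    [DecidableEq T] {U : Matrix R S ℂ} {X : Matrix R T ℂ}
    (h : X * X.conjTranspose = U * U.conjTranspose) : ∃ V : Matrix S T ℂ, X = U * V := by
  have hr : LinearMap.range X.mulVecLin = LinearMap.range U.mulVecLin := by
    rw [← range_mulVecLin_mul_conjTranspose, h, range_mulVecLin_mul_conjTranspose]
  have hc : ∀ t, ∃ v : S → ℂ, U.mulVec v = X.col t := fun t => by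
    have : X.col t ∈ LinearMap.range U.mulVecLin := by
      rw [← hr]
      exact ⟨Pi.single t 1, by simp⟩
    exact this
  choose v hv using hc
  refine ⟨Matrix.of fun s t => v t s, ?_⟩
  ext r t
  exact (congrFun (hv t) r).symm

/-- Polarisation: summing `c [e_x + c e_{x'}]` over the fourth roots of unity `c` cancels every term
except `4 |x⟩⟨x'|`. -/
theorem single_mem_span_ketbra {X : Type*} [DecidableEq X] (x x' : X) :
    Matrix.single x x' (1 : ℂ) ∈ Submodule.span ℂ (Set.range (ketbra (X := X))) := by
  let v (c : ℂ) : X → ℂ := Pi.single x 1 + c • Pi.single x' 1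
  have h : Matrix.single x x' (1 : ℂ) = (1 / 4 : ℂ) • (ketbra (v 1) - ketbra (v (-1)) +
      Complex.I • ketbra (v Complex.I) - Complex.I • ketbra (v (-Complex.I))) := by
    have key (p q r s : ℂ) : p * s = 1 / 4 * ((p + 1 * q) * (r + 1 * s) - (p + -1 * q) * (r + -1 * s) +
        Complex.I * ((p + Complex.I * q) * (r + -Complex.I * s)) -
        Complex.I * ((p + -Complex.I * q) * (r + Complex.I * s))) := by
      linear_combination 1 / 2 * (p * s - q * r) * Complex.I_mul_I
    ext a b
    have hab : Matrix.single x x' (1 : ℂ) a b =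
        (Pi.single x 1 : X → ℂ) a * (Pi.single x' 1 : X → ℂ) b := by
      by_cases ha : a = x <;> by_cases hb : b = x' <;>
        simp [ha, hb, Ne.symm]
    rw [hab, key _ ((Pi.single x' 1 : X → ℂ) a) ((Pi.single x 1 : X → ℂ) b)]
    simp [ketbra, Matrix.vecMulVec_apply, v]
  have hm (c : ℂ) : ketbra (v c) ∈ Submodule.span ℂ (Set.range (ketbra (X := X))) :=
    Submodule.subset_span ⟨_, rfl⟩
  rw [h]
  exact Submodule.smul_mem _ _ (Submodule.sub_mem _ (Submodule.add_mem _
    (Submodule.sub_mem _ (hm _) (hm _)) (Submodule.smul_mem _ _ (hm _)))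
    (Submodule.smul_mem _ _ (hm _)))

theorem span_range_ketbra (X : Type*) [Fintype X] :
    Submodule.span ℂ (Set.range (ketbra (X := X))) = ⊤ := by
  classical
  refine Submodule.eq_top_iff'.mpr fun M => ?_
  rw [Matrix.matrix_eq_sum_single M]
  refine Submodule.sum_mem _ fun i _ => Submodule.sum_mem _ fun j _ => ?_
  rw [← mul_one (M i j), ← smul_eq_mul, ← Matrix.smul_single]
  exact Submodule.smul_mem _ _ (single_mem_span_ketbra i j)

theorem trRight_ketbra {X Y : Type*} [Fintype Y] (v : X × Y → ℂ) :
    trRight (ketbra v) =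
      (Matrix.of fun x y => v (x, y)) * (Matrix.of fun x y => v (x, y)).conjTranspose := by
  ext x x'
  simp [trRight, ketbra, Matrix.mul_apply, Matrix.vecMulVec_apply]

theorem posSemidef_trRight_ketbra {X Y : Type*} [Fintype X] [Fintype Y] (v : X × Y → ℂ) :
    (trRight (ketbra v)).PosSemidef := by
  rw [trRight_ketbra]
  exact Matrix.posSemidef_self_mul_conjTranspose _

/-- Multilinear maps that agree on families taken from spanning sets are equal. -/
theorem multilinearMap_ext_of_span {ι R N : Type*} [Finite ι] [CommSemiring R] {M : ι → Type*}
    [∀ i, AddCommMonoid (M i)] [∀ i, Module R (M i)] [AddCommMonoid N] [Module R N]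
    {f g : MultilinearMap R M N} (s : ∀ i, Set (M i)) (hs : ∀ i, Submodule.span R (s i) = ⊤)
    (h : ∀ x : ∀ i, M i, (∀ i, x i ∈ s i) → f x = g x) : f = g := by
  classical
  have := Fintype.ofFinite ι
  -- `S` is the set of coordinates already allowed to be arbitrary; it is enlarged one coordinate at
  -- a time by linearity.
  suffices H : ∀ (S : Finset ι) (x : ∀ i, M i), (∀ i ∉ S, x i ∈ s i) → f x = g x from
    MultilinearMap.ext fun x => H Finset.univ x fun i hi => absurd (Finset.mem_univ i) hi
  intro S
  induction S using Finset.induction_on with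
  | empty => exact fun x hx => h x fun i => hx i (Finset.notMem_empty i)
  | insert j S hj ih =>
    intro x hx
    have key : ∀ y ∈ Submodule.span R (s j), f (Function.update x j y) = g (Function.update x j y) := by
      intro y hy
      induction hy using Submodule.span_induction with
      | mem y hy =>
        refine ih _ fun i hi => ?_
        by_cases hij : i = j
        · subst hij; simpa using hy
        · rw [Function.update_of_ne hij]
          exact hx i (by simp [hij, hi])
      | zero => simp
      | add y z _ _ hy hz => simp [hy, hz]
      | smul c y _ hy => simp [hy]
    simpa using key (x j) (by simp [hs])

end LinearAlgebra

/-! ### A matrix is determined by its link products. -/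

section Plug

variable {m : ℕ} {P F : Type*} {AI AO : Fin (m + 1) → Type*}
  [∀ k, Fintype (AI k)] [∀ k, Fintype (AO k)]

/-- An entry of the link product with `W`, as a multilinear map in the Choi matrices. -/
noncomputable def plugMultilinear
    (W : Matrix ((P × InOut AI AO Finset.univ) × F) ((P × InOut AI AO Finset.univ) × F) ℂ)
    (q q' : P × F) :
    MultilinearMap ℂ (fun k : Fin (m + 1) => Matrix (AI k × AO k) (AI k × AO k) ℂ) ℂ :=
  ∑ x : InOut AI AO Finset.univ, ∑ x' : InOut AI AO Finset.univ,
    W ((q.1, x), q.2) ((q'.1, x'), q'.2) •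
      (MultilinearMap.mkPiAlgebra ℂ (Fin (m + 1)) ℂ).compLinearMap fun k =>
        Matrix.entryLinearMap ℂ ℂ (x ⟨k, Finset.mem_univ k⟩) (x' ⟨k, Finset.mem_univ k⟩)

theorem plugMultilinear_apply
    (W : Matrix ((P × InOut AI AO Finset.univ) × F) ((P × InOut AI AO Finset.univ) × F) ℂ)
    (q q' : P × F) (C : ∀ k, Matrix (AI k × AO k) (AI k × AO k) ℂ) :
    plugMultilinear W q q' C = plug C W q q' := by
  simp [plugMultilinear, plug, mul_comm]

/-- Matrix units in every slot read off a single entry of `W`, so the multilinear map determines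
`W`. -/
theorem plug_single [∀ k, DecidableEq (AI k)] [∀ k, DecidableEq (AO k)]
    (W : Matrix ((P × InOut AI AO Finset.univ) × F) ((P × InOut AI AO Finset.univ) × F) ℂ)
    (q q' : P × F) (y y' : InOut AI AO Finset.univ) :
    plug (fun k => Matrix.single (y ⟨k, Finset.mem_univ k⟩) (y' ⟨k, Finset.mem_univ k⟩) (1 : ℂ)) W
      q q' = W ((q.1, y), q.2) ((q'.1, y'), q'.2) := by
  have hne : ∀ x x' : InOut AI AO Finset.univ, x ≠ y ∨ x' ≠ y' →
      ∏ k, Matrix.single (y ⟨k, Finset.mem_univ k⟩) (y' ⟨k, Finset.mem_univ k⟩) (1 : ℂ)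
        (x ⟨k, Finset.mem_univ k⟩) (x' ⟨k, Finset.mem_univ k⟩) = 0 := by
    intro x x' h
    rw [Finset.prod_eq_zero_iff]
    by_contra! hc
    have hk : ∀ k : (Finset.univ : Finset (Fin (m + 1))), y k = x k ∧ y' k = x' k := fun k => by
      by_contra hk
      exact hc k (Finset.mem_univ _) (by simp [hk])
    rcases h with h | h
    · exact h (funext fun k => (hk k).1.symm)
    · exact h (funext fun k => (hk k).2.symm)
  simp only [plug, Matrix.of_apply]
  rw [Finset.sum_eq_single y (fun x _ hx => Finset.sum_eq_zero fun x' _ => by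
      rw [hne x x' (Or.inl hx), zero_mul]) (by simp),
    Finset.sum_eq_single y' (fun x' _ hx' => by rw [hne y x' (Or.inr hx'), zero_mul]) (by simp)]
  simp

/-- A matrix is determined by its link products with pure external operations. -/
theorem eq_of_forall_plug_ketbra_eq
    {W W' : Matrix ((P × InOut AI AO Finset.univ) × F) ((P × InOut AI AO Finset.univ) × F) ℂ}
    (h : ∀ A : ∀ k, Matrix (AO k) (AI k) ℂ,
      plug (fun k => ketbra (choiVec (A k))) W = plug (fun k => ketbra (choiVec (A k))) W') :
    W = W' := by
  classical
  ext ⟨⟨p, y⟩, f⟩ ⟨⟨p', y'⟩, f'⟩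
  have hf : plugMultilinear W (p, f) (p', f') = plugMultilinear W' (p, f) (p', f') := by
    refine multilinearMap_ext_of_span (fun k => Set.range ketbra) (fun k => span_range_ketbra _)
      fun C hC => ?_
    choose v hv using hC
    obtain rfl : (fun k => ketbra (v k)) = C := funext hv
    rw [plugMultilinear_apply, plugMultilinear_apply]
    -- Every vector of `H^{A_k^I A_k^O}` is the Choi vector of some operator.
    exact congrFun (congrFun (h fun k => Matrix.of fun o i => v k (i, o)) (p, f)) (p', f')
  rw [← plug_single W (p, f) (p', f') y y', ← plug_single W' (p, f) (p', f') y y',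
    ← plugMultilinear_apply, hf, plugMultilinear_apply]

end Plug

/-! ### Orderings of a set, decomposed by their last element. -/

section Orderings

variable {m : ℕ}

/-- The ordering of `K` that ends with `k` and starts with an ordering of `K ∖ k`. -/
noncomputable def snocOrdering {n : ℕ} {K : Finset (Fin (m + 1))} (k : K)
    (t : Fin n ≃ K.erase (k : Fin (m + 1))) : Fin (n + 1) ≃ K :=
  Equiv.ofBijective
    (Fin.snoc (α := fun _ => (K : Type)) (fun j => ⟨t j, Finset.mem_of_mem_erase (t j).2⟩) k) <| by
    constructor
    · rw [Fin.snoc_injective_iff]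
      refine ⟨fun i j h => t.injective (Subtype.ext (congrArg (fun y : K => y.1) h)), ?_⟩
      rintro ⟨j, hj⟩
      exact Finset.ne_of_mem_erase (t j).2 (congrArg (fun y : K => y.1) hj)
    · intro y
      by_cases hy : y = k
      · exact ⟨Fin.last n, by simp [hy]⟩
      · refine ⟨(t.symm ⟨y, Finset.mem_erase.mpr ⟨fun h => hy (Subtype.ext h), y.2⟩⟩).castSucc, ?_⟩
        simp

theorem snocOrdering_last {n : ℕ} {K : Finset (Fin (m + 1))} (k : K)
    (t : Fin n ≃ K.erase (k : Fin (m + 1))) : snocOrdering k t (Fin.last n) = k := by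
  show Fin.snoc (α := fun _ => (K : Type))
    (fun j => ⟨t j, Finset.mem_of_mem_erase (t j).2⟩) k (Fin.last n) = k
  simp

theorem snocOrdering_castSucc {n : ℕ} {K : Finset (Fin (m + 1))} (k : K)
    (t : Fin n ≃ K.erase (k : Fin (m + 1))) (j : Fin n) :
    snocOrdering k t j.castSucc = ⟨t j, Finset.mem_of_mem_erase (t j).2⟩ := by
  show Fin.snoc (α := fun _ => (K : Type))
    (fun j => ⟨t j, Finset.mem_of_mem_erase (t j).2⟩) k j.castSucc = _
  simp

/-- `snocOrdering` is a bijection from pairs `(k, t)` to orderings of `K`. No cardinality hypothesis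
is needed: if `|K| ≠ n + 1`, both sums are empty. -/
theorem sum_orderings_succ {n : ℕ} (K : Finset (Fin (m + 1))) (g : (Fin n → K) → K → ℂ) :
    ∑ s : Fin (n + 1) ≃ K, g (fun j => s j.castSucc) (s (Fin.last n)) =
      ∑ k : K, ∑ t : Fin n ≃ K.erase (k : Fin (m + 1)),
        g (fun j => ⟨t j, Finset.mem_of_mem_erase (t j).2⟩) k := by
  rw [← Fintype.sum_sigma']
  symm
  refine Fintype.sum_bijective
    (fun r : Σ k : K, Fin n ≃ K.erase (k : Fin (m + 1)) => snocOrdering r.1 r.2) ⟨?_, ?_⟩ _ _ ?_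
  · rintro ⟨k, t⟩ ⟨k', t'⟩ h
    have hk : k = k' := by
      rw [← snocOrdering_last k t, ← snocOrdering_last k' t']
      exact congrArg (fun e : Fin (n + 1) ≃ K => e (Fin.last n)) h
    subst hk
    congr 1
    ext j : 2
    have := congrArg (fun e : Fin (n + 1) ≃ K => (e j.castSucc).1) h
    simpa [snocOrdering_castSucc] using this
  · intro s
    have hs : ∀ j : Fin n, (s j.castSucc).1 ∈ K.erase (s (Fin.last n)).1 := fun j =>
      Finset.mem_erase.mpr ⟨fun h => (Fin.castSucc_lt_last j).ne (s.injective (Subtype.ext h)),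
        (s j.castSucc).2⟩
    refine ⟨⟨s (Fin.last n), Equiv.ofBijective (fun j => ⟨s j.castSucc, hs j⟩) ⟨?_, ?_⟩⟩, ?_⟩
    · intro i j h
      exact Fin.castSucc_injective _ (s.injective (Subtype.ext (congrArg (fun y => y.1) h)))
    · rintro ⟨y, hy⟩
      obtain ⟨hne, hyK⟩ := Finset.mem_erase.mp hy
      obtain ⟨i, hi⟩ := s.surjective ⟨y, hyK⟩
      induction i using Fin.lastCases with
      | last => exact absurd (congrArg (fun z : K => z.1) hi).symm hne
      | cast j => exact ⟨j, Subtype.ext (congrArg (fun z : K => z.1) hi)⟩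
    · ext i
      induction i using Fin.lastCases with
      | last => rw [snocOrdering_last]
      | cast j => rw [snocOrdering_castSucc]; rfl
  · rintro ⟨k, t⟩
    simp only [snocOrdering_last, snocOrdering_castSucc]

theorem image_ordering {n : ℕ} {K : Finset (Fin (m + 1))} (t : Fin n ≃ K) :
    (Finset.univ.image fun j => (t j : Fin (m + 1))) = K := by
  ext y
  simp only [Finset.mem_image, Finset.mem_univ, true_and]
  exact ⟨fun ⟨j, hj⟩ => hj ▸ (t j).2, fun hy => ⟨t.symm ⟨y, hy⟩, by simp⟩⟩

end Orderings

/-! ### Separating the factor `A_k^{IO}` from the rest. -/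

section Splitting

variable {m : ℕ} {AI AO : Fin (m + 1) → Type*}

theorem sum_inOut_eq [∀ k, Fintype (AI k)] [∀ k, Fintype (AO k)] {P : Type*}
    {K : Finset (Fin (m + 1))} (k : K) (p : P)
    (g : ((P × InOut AI AO (K.erase (k : Fin (m + 1)))) × AI k) × AO k → ℂ) :
    ∑ x : InOut AI AO K, g (split k (p, x)) =
      ∑ x : InOut AI AO (K.erase (k : Fin (m + 1))), ∑ i, ∑ o, g (((p, x), i), o) := by
  have h : ∑ x : InOut AI AO (K.erase (k : Fin (m + 1))), ∑ i, ∑ o, g (((p, x), i), o) =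
      ∑ y : (InOut AI AO (K.erase (k : Fin (m + 1))) × AI k) × AO k, g (((p, y.1.1), y.1.2), y.2) := by
    simp only [Fintype.sum_prod_type]
  rw [h]
  refine Fintype.sum_bijective
    (fun x => (((split k (p, x)).1.1.2, (x k).1), (x k).2)) ⟨?_, ?_⟩ _ _ fun x => rfl
  · intro x y h
    simp only [split, Prod.mk.injEq] at h
    obtain ⟨⟨h₁, h₂⟩, h₃⟩ := h
    funext j
    by_cases hj : j = k
    · subst hj; exact Prod.ext h₂ h₃
    · exact congrFun h₁ ⟨j, Finset.mem_erase.mpr ⟨fun h => hj (Subtype.ext h), j.2⟩⟩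
  · rintro ⟨⟨x, i⟩, o⟩
    refine ⟨fun j => if h : j = k then h ▸ (i, o) else
      x ⟨j, Finset.mem_erase.mpr ⟨fun h' => h (Subtype.ext h'), j.2⟩⟩, ?_⟩
    have : ∀ j : K.erase (k : Fin (m + 1)),
        (⟨j, Finset.mem_of_mem_erase j.2⟩ : K) ≠ k := fun j h =>
      Finset.ne_of_mem_erase j.2 (congrArg (fun z : K => z.1) h)
    simp [split, this]

theorem prod_eq_mul_prod_erase {K : Finset (Fin (m + 1))} (k : K) (a : K → ℂ) :
    ∏ j, a j = a k * ∏ j : K.erase (k : Fin (m + 1)), a ⟨j, Finset.mem_of_mem_erase j.2⟩ := by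
  rw [← Finset.mul_prod_erase Finset.univ a (Finset.mem_univ k)]
  congr 1
  symm
  refine Finset.prod_bij (fun j _ => ⟨j, Finset.mem_of_mem_erase j.2⟩) ?_ ?_ ?_ fun _ _ => rfl
  · intro j _
    exact Finset.mem_erase.mpr ⟨fun h => Finset.ne_of_mem_erase j.2
      (congrArg (fun z : K => z.1) h), Finset.mem_univ _⟩
  · intro i _ j _ h
    exact Subtype.ext (congrArg (fun z : K => z.1) h)
  · intro j hj
    exact ⟨⟨j, Finset.mem_erase.mpr ⟨fun h => (Finset.mem_erase.mp hj).1 (Subtype.ext h), j.2⟩⟩,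
      Finset.mem_univ _, rfl⟩

end Splitting

/-! ### Recursion for the vectors `w`, and the operator applied by the circuit. -/

namespace Internal

variable {m : ℕ} {P F : Type*} {AI AO : Fin (m + 1) → Type*} (C : Internal P AI AO F)

theorem w_zero (k : Fin (m + 1)) (p : P) (x : InOut AI AO ∅) (i : AI k) (a : Fin (C.anc 1)) :
    C.w 0 ∅ k (((p, x), i), a) = C.first k (i, a) p := by
  have : Unique (Fin 0 ≃ (∅ : Finset (Fin (m + 1)))) :=
    { default := Equiv.equivOfIsEmpty _ _, uniq := fun _ => Equiv.ext fun j => j.elim0 }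
  simp [w, wSeq, choiVec]

/-- The last internal operation depends on the preceding labels only through their set `K ∖ k`. For
fixed last label `k`, the sum over orderings therefore factors through `w_{(K∖k,k)}`. -/
theorem w_succ (n : ℕ) (K : Finset (Fin (m + 1))) (k' : Fin (m + 1)) (p : P) (x : InOut AI AO K)
    (i : AI k') (a : Fin (C.anc (n + 2))) :
    C.w (n + 1) K k' (((p, x), i), a) = ∑ k : K, ∑ b,
      C.w n (K.erase (k : Fin (m + 1))) k ((split k (p, x)).1, b) *
        C.step (n + 1) (K.erase (k : Fin (m + 1))) k k' (i, a) ((x k).2, b) := by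
  simp only [w, wSeq]
  rw [sum_orderings_succ K fun s k => ∑ b,
    C.wSeq n (fun j => s j) (fun j => x (s j)) p k (x k).1 b *
      choiVec (C.step (n + 1) (Finset.univ.image fun j => (s j : Fin (m + 1))) k k')
        (((x k).2, b), (i, a))]
  refine Finset.sum_congr rfl fun k _ => ?_
  rw [Finset.sum_comm]
  refine Finset.sum_congr rfl fun b _ => ?_
  rw [Finset.sum_mul]
  refine Finset.sum_congr rfl fun t _ => ?_
  rw [image_ordering t]
  rfl

theorem wF_eq (p : P) (x : InOut AI AO Finset.univ) (f : F) (a : Fin C.ancF) :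
    C.wF (((p, x), f), a) = ∑ k : (Finset.univ : Finset (Fin (m + 1))), ∑ b,
      C.w m (Finset.univ.erase (k : Fin (m + 1))) k ((split k (p, x)).1, b) *
        C.last k (f, a) ((x k).2, b) := by
  simp only [w, wF]
  rw [sum_orderings_succ Finset.univ fun s k => ∑ b,
    C.wSeq m (fun j => s j) (fun j => x (s j)) p k (x k).1 b *
      choiVec (C.last k) (((x k).2, b), (f, a))]
  refine Finset.sum_congr rfl fun k _ => ?_
  rw [Finset.sum_comm]
  refine Finset.sum_congr rfl fun b _ => ?_
  rw [Finset.sum_mul]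
  rfl

section Circuit

/-- The control states that can lead to the set `K` are exactly `|K ∖ k, k⟩` with `k ∈ K`. -/
theorem sum_ctl_eq {n : ℕ} {K : Finset (Fin (m + 1))} (hK : K.card = n + 1) (g : Ctl m n → ℂ) :
    (∑ c : Ctl m n, if K = insert c.1.2 c.1.1 then g c else 0) =
      ∑ k : K, g ⟨(K.erase (k : Fin (m + 1)), k),
        by rw [Finset.card_erase_of_mem k.2, hK]; rfl, Finset.notMem_erase _ _⟩ := by
  rw [← Finset.sum_filter]
  symm
  refine Finset.sum_bij (fun k _ => ⟨(K.erase (k : Fin (m + 1)), k),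
    by rw [Finset.card_erase_of_mem k.2, hK]; rfl, Finset.notMem_erase _ _⟩) ?_ ?_ ?_ fun _ _ => rfl
  · intro k _
    simp [Finset.insert_erase k.2]
  · intro k _ k' _ h
    exact Subtype.ext (congrArg (fun c : Ctl m n => c.1.2) h)
  · rintro ⟨⟨K', k⟩, hc, hk⟩ h
    simp only [Finset.mem_filter, Finset.mem_univ, true_and] at h hk
    subst h
    exact ⟨⟨k, Finset.mem_insert_self _ _⟩, Finset.mem_univ _,
      Subtype.ext (Prod.ext (Finset.erase_insert hk) rfl)⟩

variable [∀ k, Fintype (AI k)] (A : ∀ k, Matrix (AO k) (AI k) ℂ)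

theorem extOp_mul_apply (n : ℕ) (M : Matrix (C.Pre n) P ℂ) (c : Ctl m n) (o : AO c.1.2)
    (b : Fin (C.anc (n + 1))) (p : P) :
    (C.extOp A n * M) ⟨c, (o, b)⟩ p = ∑ i, A c.1.2 o i * M ⟨c, (i, b)⟩ p := by
  rw [Matrix.mul_apply, Fintype.sum_sigma, Finset.sum_eq_single c]
  · simp [extOp, Matrix.blockDiagonal'_apply_eq, Fintype.sum_prod_type, Matrix.one_apply]
  · intro c' _ hc
    exact Finset.sum_eq_zero fun y _ => by
      rw [extOp, Matrix.blockDiagonal'_apply_ne _ _ _ hc.symm, zero_mul]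
  · simp

variable [∀ k, Fintype (AO k)]

/-- Feeding the external operations into a vector with one more pair of input and output spaces. -/
theorem sum_prod_mul_split {K : Finset (Fin (m + 1))} (k : K) (p : P)
    (v : (P × InOut AI AO (K.erase (k : Fin (m + 1)))) × AI k → ℂ) (u : AO k → ℂ) :
    ∑ x : InOut AI AO K, (∏ j : K, A j (x j).2 (x j).1) * (v (split k (p, x)).1 * u (x k).2) =
      ∑ o, u o * ∑ i, A k o i * ∑ x : InOut AI AO (K.erase (k : Fin (m + 1))),
        (∏ j : K.erase (k : Fin (m + 1)), A j (x j).2 (x j).1) * v ((p, x), i) := by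
  have h := sum_inOut_eq k p fun y : ((P × InOut AI AO (K.erase (k : Fin (m + 1)))) × AI k) × AO k =>
    (A k y.2 y.1.2 * ∏ j : K.erase (k : Fin (m + 1)), A j (y.1.1.2 j).2 (y.1.1.2 j).1) *
      (v y.1 * u y.2)
  calc _ = _ := Finset.sum_congr rfl fun x _ => by
          rw [prod_eq_mul_prod_erase k]; rfl
       _ = _ := h
       _ = _ := by
        simp only [Finset.mul_sum]
        rw [Finset.sum_comm_cycle]
        refine Finset.sum_congr rfl fun o _ => ?_
        rw [Finset.sum_comm]
        refine Finset.sum_congr rfl fun i _ => Finset.sum_congr rfl fun x _ => ?_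
        ring

/-- The control remembers the set of past operations but not their order, so amplitudes of different
orders of `K` add coherently. This is the recursion `w_succ`, and the induction matches it with
`stepOp`. -/
theorem evol_apply (n : ℕ) (c : Ctl m n) (i : AI c.1.2) (a : Fin (C.anc (n + 1))) (p : P) :
    C.evol A n ⟨c, (i, a)⟩ p = ∑ x : InOut AI AO c.1.1,
      (∏ j : c.1.1, A j (x j).2 (x j).1) * C.w n c.1.1 c.1.2 (((p, x), i), a) := by
  induction n with
  | zero =>
    obtain ⟨⟨K, k⟩, hc, hk⟩ := c
    obtain rfl : K = ∅ := Finset.card_eq_zero.mp hc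
    simp [evol, firstOp, w_zero]
  | succ n ih =>
    obtain ⟨⟨K, k'⟩, hc, hk⟩ := c
    simp only at i hc hk ⊢
    have hsum : C.evol A (n + 1) ⟨⟨(K, k'), hc, hk⟩, (i, a)⟩ p =
        ∑ c : Ctl m n, if K = insert c.1.2 c.1.1 then
          ∑ o, ∑ b, C.step (n + 1) c.1.1 c.1.2 k' (i, a) (o, b) *
            ∑ i, A c.1.2 o i * C.evol A n ⟨c, (i, b)⟩ p else 0 := by
      rw [evol, Matrix.mul_apply, Fintype.sum_sigma]
      refine Finset.sum_congr rfl fun c _ => ?_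
      rw [Fintype.sum_prod_type]
      split_ifs with h
      · simp only [extOp_mul_apply, stepOp, Matrix.of_apply, if_pos h]
      · simp only [stepOp, Matrix.of_apply, if_neg h, zero_mul, Finset.sum_const_zero]
    rw [hsum, sum_ctl_eq hc]
    simp only [w_succ, Finset.mul_sum, ih]
    rw [Finset.sum_comm]
    refine Finset.sum_congr rfl fun k _ => ?_
    rw [Finset.sum_comm, Finset.sum_comm (s := (Finset.univ : Finset (InOut AI AO K)))]
    refine Finset.sum_congr rfl fun b _ => ?_
    rw [sum_prod_mul_split A k p
      (fun y => C.w n (K.erase (k : Fin (m + 1))) k (y, b))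
      fun o => C.step (n + 1) (K.erase (k : Fin (m + 1))) k k' (i, a) (o, b)]
    simp only [Finset.mul_sum]

theorem globalOp_apply (f : F) (a : Fin C.ancF) (p : P) :
    C.globalOp A (f, a) p = ∑ x : InOut AI AO Finset.univ,
      (∏ j : (Finset.univ : Finset (Fin (m + 1))), A j (x j).2 (x j).1) *
        C.wF (((p, x), f), a) := by
  have hcard : (Finset.univ : Finset (Fin (m + 1))).card = m + 1 := by simp
  have hsum : C.globalOp A (f, a) p =
      ∑ c : Ctl m m, if Finset.univ = insert c.1.2 c.1.1 then
        ∑ o, ∑ b, C.last c.1.2 (f, a) (o, b) *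
          ∑ i, A c.1.2 o i * C.evol A m ⟨c, (i, b)⟩ p else 0 := by
    rw [globalOp, Matrix.mul_apply, Fintype.sum_sigma]
    refine Finset.sum_congr rfl fun c _ => ?_
    -- In the last slot `K ∪ k` has `m + 1` elements, so the condition of `sum_ctl_eq` holds for
    -- every control state.
    have hc : Finset.univ = insert c.1.2 c.1.1 := by
      symm
      rw [← Finset.card_eq_iff_eq_univ, Finset.card_insert_of_notMem c.2.2, c.2.1]
      simp
    rw [Fintype.sum_prod_type, if_pos hc]
    simp only [extOp_mul_apply, lastOp, Matrix.of_apply]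
  rw [hsum, sum_ctl_eq hcard]
  simp only [wF_eq, Finset.mul_sum, evol_apply]
  rw [Finset.sum_comm]
  refine Finset.sum_congr rfl fun k _ => ?_
  rw [Finset.sum_comm, Finset.sum_comm (s := (Finset.univ : Finset (InOut AI AO Finset.univ)))]
  refine Finset.sum_congr rfl fun b _ => ?_
  rw [sum_prod_mul_split A k p
    (fun y => C.w m (Finset.univ.erase (k : Fin (m + 1))) k (y, b))
    fun o => C.last k (f, a) (o, b)]
  simp only [Finset.mul_sum]

/-- The process matrix of the circuit is `Tr_{α_F} |w_{(N,F)}⟩⟨w_{(N,F)}|`. -/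
theorem inducedChoi_eq :
    C.inducedChoi A = plug (fun k => ketbra (choiVec (A k))) (trRight (ketbra C.wF)) := by
  have hprod : ∀ g : ↥(Finset.univ : Finset (Fin (m + 1))) → ℂ,
      ∏ j, g j = ∏ j, g ⟨j, Finset.mem_univ j⟩ := fun g =>
    (Fintype.prod_equiv (Equiv.subtypeUnivEquiv Finset.mem_univ) _ _ fun _ => rfl)
  ext ⟨p, f⟩ ⟨p', f'⟩
  simp only [inducedChoi, trRight, ketbra, choiVec, plug, Matrix.of_apply, Matrix.vecMulVec_apply,
    Pi.star_apply, globalOp_apply, star_sum, star_mul', star_prod, Finset.prod_mul_distrib, hprod,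
    Finset.sum_mul_sum]
  simp only [Finset.mul_sum]
  rw [Finset.sum_comm]
  refine Finset.sum_congr rfl fun x _ => ?_
  rw [Finset.sum_comm]
  refine Finset.sum_congr rfl fun x' _ => Finset.sum_congr rfl fun a _ => ?_
  ring

theorem HasProcessMatrix.eq
    {W : Matrix ((P × InOut AI AO Finset.univ) × F) ((P × InOut AI AO Finset.univ) × F) ℂ}
    (h : C.HasProcessMatrix W) : W = trRight (ketbra C.wF) :=
  eq_of_forall_plug_ketbra_eq fun A => by rw [← h.2 A, inducedChoi_eq]

end Circuit

end Internal

/-! ### Internal operations recovered from Gram factors. -/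

section Construction

variable {m : ℕ} {P : Type*} {AI AO : Fin (m + 1) → Type*}
  [Fintype P] [∀ k, Fintype (AI k)] [∀ k, Fintype (AO k)] [∀ k, DecidableEq (AO k)]

/-- If `X Xᴴ = ∑ₖ (Bₖ Bₖᴴ) ⊗ 𝟙^{A_k^O}`, then `X` is obtained from the `Bₖ` by internal operations
of a circuit. -/
theorem exists_internal_of_mul_conjTranspose_eq {K : Finset (Fin (m + 1))} {d : ℕ} {T : Type*}
    [Fintype T] [DecidableEq T]
    (B : ∀ k : K, Matrix ((P × InOut AI AO (K.erase (k : Fin (m + 1)))) × AI k) (Fin d) ℂ)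
    (X : Matrix (P × InOut AI AO K) T ℂ)
    (h : X * X.conjTranspose = ∑ k : K, tensorId k (B k * (B k).conjTranspose)) :
    ∃ v : ∀ k : K, Matrix T (AO k × Fin d) ℂ, ∀ p x t,
      X (p, x) t = ∑ k : K, ∑ b, B k (split k (p, x)).1 b * v k t ((x k).2, b) := by
  -- The blocks `B k ⊗ 𝟙^{A_k^O}` side by side; the column label `o` records the output of `A_k`.
  let U : Matrix (P × InOut AI AO K) (Σ k : K, AO k × Fin d) ℂ := Matrix.of fun q s =>
    if (q.2 s.1).2 = s.2.1 then B s.1 (split s.1 q).1 s.2.2 else 0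
  have hU : U * U.conjTranspose = ∑ k : K, tensorId k (B k * (B k).conjTranspose) := by
    ext q q'
    rw [Matrix.sum_apply, Matrix.mul_apply, Fintype.sum_sigma]
    refine Finset.sum_congr rfl fun k _ => ?_
    rw [Fintype.sum_prod_type]
    simp only [U, tensorId, Matrix.submatrix_apply, Matrix.kroneckerMap_apply, Matrix.of_apply,
      Matrix.conjTranspose_apply, Matrix.mul_apply, Matrix.one_apply]
    rw [Finset.sum_eq_single (q.2 k).2 (fun o _ ho => by simp [ho.symm]) (by simp)]
    by_cases hq : (q.2 k).2 = (q'.2 k).2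
    · simp [split, hq]
    · simp [split, hq, Ne.symm hq]
  obtain ⟨V, hV⟩ := exists_eq_mul_of_mul_conjTranspose_eq (h.trans hU.symm)
  refine ⟨fun k => Matrix.of fun t s => V ⟨k, s⟩ t, fun p x t => ?_⟩
  rw [hV, Matrix.mul_apply, Fintype.sum_sigma]
  refine Finset.sum_congr rfl fun k _ => ?_
  rw [Fintype.sum_prod_type, Finset.sum_eq_single (x k).2 (fun o _ ho => by
    simp [U, ho.symm]) (by simp)]
  simp [U]

theorem exists_step_of_sum_trRight_eq {d : ℕ}
    (B : ∀ (K : Finset (Fin (m + 1))) (k : Fin (m + 1)),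
      Matrix ((P × InOut AI AO K) × AI k) (Fin d) ℂ) [∀ k, DecidableEq (AI k)]
    (K : Finset (Fin (m + 1)))
    (h : ∑ k ∈ Kᶜ, trRight (B K k * (B K k).conjTranspose) =
      ∑ k : K, tensorId k (B (K.erase (k : Fin (m + 1))) k *
        (B (K.erase (k : Fin (m + 1))) k).conjTranspose)) :
    ∃ v : ∀ k k' : Fin (m + 1), Matrix (AI k' × Fin d) (AO k × Fin d) ℂ,
      ∀ k', k' ∉ K → ∀ p x i a, B K k' ((p, x), i) a = ∑ k : K, ∑ b,
        B (K.erase (k : Fin (m + 1))) k (split k (p, x)).1 b * v k k' (i, a) ((x k).2, b) := by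
  -- With `A_{k'}^I` among the columns, the partial traces on the left of `h` become `X Xᴴ`. All
  -- `k'` are treated together, so a single `V` supplies every transition out of `K`.
  let X : Matrix (P × InOut AI AO K) (Σ k' : (Kᶜ : Finset (Fin (m + 1))), AI k' × Fin d) ℂ :=
    Matrix.of fun q t => B K t.1 (q, t.2.1) t.2.2
  have hX : X * X.conjTranspose = ∑ k ∈ Kᶜ, trRight (B K k * (B K k).conjTranspose) := by
    ext q q'
    rw [Matrix.sum_apply, Matrix.mul_apply, Fintype.sum_sigma,
      ← Finset.sum_coe_sort Kᶜ fun k => trRight (B K k * (B K k).conjTranspose) q q']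
    refine Finset.sum_congr rfl fun k _ => ?_
    rw [Fintype.sum_prod_type]
    simp [X, trRight, Matrix.mul_apply]
  obtain ⟨v, hv⟩ := exists_internal_of_mul_conjTranspose_eq
    (fun k : K => B (K.erase (k : Fin (m + 1))) k) X (hX.trans h)
  refine ⟨fun k k' => if hk : k ∈ K ∧ k' ∈ Kᶜ then
    Matrix.of fun r s => v ⟨k, hk.1⟩ ⟨⟨k', hk.2⟩, r⟩ s else 0, fun k' hk' p x i a => ?_⟩
  have hk'' : k' ∈ Kᶜ := Finset.mem_compl.mpr hk'
  refine (hv p x ⟨⟨k', hk''⟩, (i, a)⟩).trans ?_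
  refine Finset.sum_congr rfl fun k _ => Finset.sum_congr rfl fun b _ => ?_
  simp [hk']

end Construction

end QCQC

/-! ### The characterisation. -/

theorem proposition7 {m : ℕ} {P F : Type*} {AI AO : Fin (m + 1) → Type*}
    [Fintype P] [DecidableEq P] [Fintype F] [DecidableEq F]
    [∀ k, Fintype (AI k)] [∀ k, DecidableEq (AI k)]
    [∀ k, Fintype (AO k)] [∀ k, DecidableEq (AO k)]
    (W : Matrix ((P × QCQC.InOut AI AO Finset.univ) × F)
      ((P × QCQC.InOut AI AO Finset.univ) × F) ℂ) :
    QCQC.IsProcessMatrixOfQCQC W ↔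
      W.PosSemidef ∧
      ∃ Wd : ∀ (K : Finset (Fin (m + 1))) (k : Fin (m + 1)),
          Matrix ((P × QCQC.InOut AI AO K) × AI k) ((P × QCQC.InOut AI AO K) × AI k) ℂ,
        (∀ K k, k ∉ K → (Wd K k).PosSemidef) ∧
        ∑ k, QCQC.trRight (Wd ∅ k) = 1 ∧
        (∀ K : Finset (Fin (m + 1)), K ≠ ∅ → K ≠ Finset.univ →
          ∑ k ∈ Kᶜ, QCQC.trRight (Wd K k) =
            ∑ k : K, QCQC.tensorId k (Wd (K.erase (k : Fin (m + 1))) k)) ∧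
        QCQC.trRight W =
          ∑ k : (Finset.univ : Finset (Fin (m + 1))),
            QCQC.tensorId k (Wd (Finset.univ.erase (k : Fin (m + 1))) k) := by
  classical
  constructor
  · rintro ⟨C, hTP, hW⟩
    obtain rfl := QCQC.Internal.HasProcessMatrix.eq C hW
    refine ⟨QCQC.posSemidef_trRight_ketbra _,
      fun K k => QCQC.trRight (QCQC.ketbra (C.w K.card K k)),
      fun K k _ => QCQC.posSemidef_trRight_ketbra _, hTP.first, fun K hK hK' => ?_, ?_⟩
    · obtain ⟨n, hn⟩ := Nat.exists_eq_succ_of_ne_zero (Finset.card_ne_zero.mpr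
        (Finset.nonempty_iff_ne_empty.mpr hK))
      have hlt : K.card < m + 1 := by
        simpa using Finset.card_lt_univ_of_notMem (s := K)
          (Classical.choose_spec (not_forall.mp fun h => hK' (Finset.eq_univ_iff_forall.mpr h)))
      have he : ∀ k : K, (K.erase (k : Fin (m + 1))).card = n := fun k => by
        rw [Finset.card_erase_of_mem k.2, hn]; rfl
      -- The slot index occurs in the type of `w`, but not in that of its partial trace, so it is
      -- replaced outside `trRight`.
      rw [Finset.sum_congr rfl fun (k : K) _ => congrArg (QCQC.tensorId k)
        (congrArg (fun l => QCQC.trRight (QCQC.ketbra (C.w l (K.erase (k : Fin (m + 1))) k))) (he k))]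
      beta_reduce
      rw [hn]
      exact hTP.step n K (by omega) hn
    · have he : ∀ k : (Finset.univ : Finset (Fin (m + 1))),
          (Finset.univ.erase (k : Fin (m + 1))).card = m := fun k => by
        rw [Finset.card_erase_of_mem k.2]; simp
      rw [Finset.sum_congr rfl fun k _ => congrArg (QCQC.tensorId k)
        (congrArg (fun l => QCQC.trRight (QCQC.ketbra (C.w l (Finset.univ.erase
          (k : Fin (m + 1))) k))) (he k))]
      exact hTP.last
  · rintro ⟨hW, Wd, hpos, hfirst, hstep, hlast⟩
    -- In `Internal` the ancilla dimension may depend on the slot but not on `(K, k)`; one common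
    -- bound `d` serves all slots.
    obtain ⟨d, hd⟩ : ∃ d : ℕ, ∀ K k, Fintype.card ((P × QCQC.InOut AI AO K) × AI k) ≤ d :=
      ⟨∑ K, ∑ k, Fintype.card ((P × QCQC.InOut AI AO K) × AI k), fun K k =>
        (Finset.single_le_sum (f := fun k => Fintype.card ((P × QCQC.InOut AI AO K) × AI k))
          (fun _ _ => Nat.zero_le _) (Finset.mem_univ k)).trans
        (Finset.single_le_sum
          (f := fun K => ∑ k, Fintype.card ((P × QCQC.InOut AI AO K) × AI k))
          (fun _ _ => Nat.zero_le _) (Finset.mem_univ K))⟩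
    have hB : ∀ K k, ∃ B : Matrix ((P × QCQC.InOut AI AO K) × AI k) (Fin d) ℂ,
        k ∉ K → B * B.conjTranspose = Wd K k := fun K k => by
      by_cases hk : k ∈ K
      · exact ⟨0, fun h => absurd hk h⟩
      · obtain ⟨B, hB⟩ := QCQC.exists_eq_mul_conjTranspose (hpos K k hk) (hd K k)
        exact ⟨B, fun _ => hB⟩
    choose B hB using hB
    have hBe : ∀ (K : Finset (Fin (m + 1))) (k : K), B (K.erase (k : Fin (m + 1))) k *
        (B (K.erase (k : Fin (m + 1))) k).conjTranspose = Wd (K.erase (k : Fin (m + 1))) k :=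
      fun K k => hB _ _ (Finset.notMem_erase _ _)
    obtain ⟨BF, hBF⟩ := QCQC.exists_eq_mul_conjTranspose hW le_rfl
    have hv : ∀ K : Finset (Fin (m + 1)),
        ∃ v : ∀ k k' : Fin (m + 1), Matrix (AI k' × Fin d) (AO k × Fin d) ℂ,
          K ≠ ∅ → ∀ k', k' ∉ K → ∀ p x i a, B K k' ((p, x), i) a = ∑ k : K, ∑ b,
            B (K.erase (k : Fin (m + 1))) k (QCQC.split k (p, x)).1 b *
              v k k' (i, a) ((x k).2, b) := fun K => by
      by_cases hK : K ≠ ∅ ∧ K ≠ Finset.univ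
      · obtain ⟨v, hv⟩ := QCQC.exists_step_of_sum_trRight_eq B K (by
          rw [Finset.sum_congr rfl fun k hk => by rw [hB K k (Finset.mem_compl.mp hk)]]
          simp only [hBe]
          exact hstep K hK.1 hK.2)
        exact ⟨v, fun _ => hv⟩
      -- Here `K` is empty or everything; in the latter case there is no `k' ∉ K`.
      · refine ⟨0, fun hne k' hk' => absurd (Finset.mem_univ k') ?_⟩
        rwa [← not_not.mp fun h => hK ⟨hne, h⟩]
    choose v hv using hv
    obtain ⟨u, hu⟩ := QCQC.exists_internal_of_mul_conjTranspose_eq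
      (fun k : (Finset.univ : Finset (Fin (m + 1))) => B (Finset.univ.erase (k : Fin (m + 1))) k)
      -- `F` moves to the columns, so the condition on `Tr_F W` is again a Gram identity.
      (Matrix.of fun q (t : F × Fin _) => BF (q, t.1) t.2) (by
        simp only [hBe]
        rw [← hlast, ← hBF]
        ext q q'
        rw [Matrix.mul_apply, Fintype.sum_prod_type]
        simp [QCQC.trRight, Matrix.mul_apply])
    let C : QCQC.Internal P AI AO F :=
      { anc := fun _ => d
        ancF := Fintype.card ((P × QCQC.InOut AI AO Finset.univ) × F)
        first := fun k => Matrix.of fun r p => B ∅ k ((p, fun j => absurd j.2 (Finset.notMem_empty _)), r.1) r.2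
        -- `v` is indexed by the set that already contains `k`, whereas `step` receives the set
        -- before `k` is added.
        step := fun _ K k k' => v (insert k K) k k'
        last := fun k => u ⟨k, Finset.mem_univ k⟩ }
    have hCw : ∀ (n : ℕ) (K : Finset (Fin (m + 1))) (k : Fin (m + 1)), K.card = n → k ∉ K →
        C.w n K k = fun q => B K k q.1 q.2 := by
      intro n
      induction n with
      | zero =>
        rintro K k hK -
        obtain rfl := Finset.card_eq_zero.mp hK
        funext ⟨⟨⟨p, x⟩, i⟩, a⟩
        rw [QCQC.Internal.w_zero]
        simp only [C, Matrix.of_apply]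
        congr
        funext j
        exact absurd j.2 (Finset.notMem_empty _)
      | succ n ih =>
        intro K k' hK hk'
        funext ⟨⟨⟨p, x⟩, i⟩, a⟩
        have hne : K ≠ ∅ := fun h => by simp [h] at hK
        rw [QCQC.Internal.w_succ, hv K hne k' hk']
        refine Finset.sum_congr rfl fun k _ => Finset.sum_congr rfl fun b _ => ?_
        rw [ih _ k (by rw [Finset.card_erase_of_mem k.2, hK]; rfl) (Finset.notMem_erase _ _)]
        simp only [C, Finset.insert_erase k.2]
    have hCwF : C.wF = fun q => BF q.1 q.2 := by
      funext ⟨⟨⟨p, x⟩, f⟩, a⟩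
      rw [QCQC.Internal.wF_eq]
      refine Eq.trans ?_ (hu p x (f, a)).symm
      refine Finset.sum_congr rfl fun k _ => Finset.sum_congr rfl fun b _ => ?_
      rw [hCw m _ k (by rw [Finset.card_erase_of_mem k.2]; simp) (Finset.notMem_erase _ _)]
    have hWd : ∀ (n : ℕ) (K : Finset (Fin (m + 1))) (k : Fin (m + 1)), K.card = n → k ∉ K →
        QCQC.trRight (QCQC.ketbra (C.w n K k)) = Wd K k := fun n K k hK hk => by
      rw [hCw n K k hK hk, QCQC.trRight_ketbra]
      exact hB K k hk
    have hWF : QCQC.trRight (QCQC.ketbra C.wF) = W := by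
      rw [hCwF, QCQC.trRight_ketbra]
      exact hBF
    refine ⟨C, ⟨?_, fun n K hn hK => ?_, ?_⟩, hW.isHermitian, fun A => ?_⟩
    · simpa only [hWd 0 ∅ _ rfl (Finset.notMem_empty _)] using hfirst
    · rw [Finset.sum_congr rfl fun k hk => by rw [hWd (n + 1) K k hK (Finset.mem_compl.mp hk)],
        hstep K (fun h => by simp [h] at hK) (fun h => by simp [h] at hK; omega)]
      exact Finset.sum_congr rfl fun k _ => by
        rw [hWd n _ k (by rw [Finset.card_erase_of_mem k.2, hK]; rfl) (Finset.notMem_erase _ _)]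
    · rw [hWF, hlast]
      exact Finset.sum_congr rfl fun k _ => by
        rw [hWd m _ k (by rw [Finset.card_erase_of_mem k.2]; simp) (Finset.notMem_erase _ _)]
    · rw [C.inducedChoi_eq, hWF]
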